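/- Let $n\ge 1$ be a fixed integer. There is a constant $C=C(n)$ such that for every finite field $\mathbb F$ with $\operatorname{char}\mathbb F\neq 2$, writing $q=|\mathbb F|$, and for every $\alpha\in\mathbb F$, a uniformly random matrix $A\in M_n(\mathbb F)$ satisfies $$\Bigl|P(\det A=\alpha)-\frac1q\Bigr|\le \frac{C}{q^2}\qquad\text{and}\qquad \Bigl|P(\operatorname{per} A=\alpha)-\frac1q\Bigr|\le \frac{C}{q^2},$$ where $P(\det A=\alpha)=|\{A\in M_n(\mathbb F):\det A=\alpha\}|/q^{n^2}$, and similarly for the permanent $\operatorname{per}A=\sum_{\sigma\in S_n}\prod_{i=1}^n a_{i\sigma(i)}$. That is, for fixed $n$ both probabilities are equal to $\frac1q+O\bigl(\frac1{q^2}\bigr)$ as $q\to\infty$, uniformly in $\mathbb F$ and $\alpha$. -/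

import Mathlib

/-- The probability of an event `E` in a finite sample space `Ω` with the uniform distribution:
the number of favourable outcomes divided by the number of all outcomes. -/
noncomputable def uniformProb {Ω : Type*} [Finite Ω] (E : Set Ω) : ℝ :=
  (E.ncard : ℝ) / (Nat.card Ω : ℝ)

open Finset Matrix

/-! Given the lower `m = n - 1` rows, both functions are linear forms in the first row whose
coefficients are, up to sign, the maximal minors (or subpermanents) of those rows. A nonzero form
takes each value with probability exactly `1/q`, so the error is at most the probability `p_m` that
all these coefficients vanish. Transposing, two of the vanishing conditions one size up apply the
same form to two independent rows; if the form is nonzero, both hold with probability `1/q^2`. Hence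
`p_{m+1} ≤ p_m + 1/q^2` with `p_0 = 0`, so `p_m ≤ m/q^2`. -/

/-- Laplace expansion of the permanent along the first column. -/
theorem permanent_succ_column_zero {R : Type*} [CommSemiring R] {n : ℕ}
    (A : Matrix (Fin (n + 1)) (Fin (n + 1)) R) :
    A.permanent = ∑ i, A i 0 * (A.submatrix i.succAbove Fin.succ).permanent := by
  rw [permanent, ← (Equiv.Perm.decomposeFin (n := n)).symm.sum_comp, Fintype.sum_prod_type]
  refine Fintype.sum_congr _ _ fun p => ?_
  have hne (y : Fin n) : Equiv.swap 0 p y.succ ≠ p := by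
    rw [Ne, Equiv.swap_apply_eq_iff, Equiv.swap_apply_right]
    exact Fin.succ_ne_zero y
  -- `swap 0 p` lists the indices other than `p` in an order that differs from `p.succAbove` by the
  -- permutation `π`, which the permanent does not see.
  choose π hπ using fun y => Fin.exists_succAbove_eq (hne y)
  have hinj : Function.Injective π := fun x y h => by
    have := (hπ x).symm.trans ((congrArg p.succAbove h).trans (hπ y))
    exact Fin.succ_injective _ ((Equiv.swap 0 p).injective this)
  have h := permanent_permute_cols (Equiv.ofBijective π (Finite.injective_iff_bijective.mp hinj))
    (A.submatrix p.succAbove Fin.succ)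
  rw [← h, permanent, mul_sum]
  refine Fintype.sum_congr _ _ fun e => ?_
  simp [Fin.prod_univ_succ, hπ]

/-- Laplace expansion of the permanent along the first row. -/
theorem permanent_succ_row_zero {R : Type*} [CommSemiring R] {n : ℕ}
    (A : Matrix (Fin (n + 1)) (Fin (n + 1)) R) :
    A.permanent = ∑ j, A 0 j * (A.submatrix Fin.succ j.succAbove).permanent := by
  rw [← permanent_transpose A, permanent_succ_column_zero]
  refine Fintype.sum_congr _ _ fun i => ?_
  rw [← permanent_transpose]
  simp [transpose_submatrix]

/-- A family of functions on square matrices, invariant under transposition, with a Laplace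
expansion along the first row whose signs (or weights) are nonzero. -/
structure LaplaceFamily (F : Type*) [Field F] where
  toFun : ∀ k : ℕ, Matrix (Fin k) (Fin k) F → F
  weight : ℕ → F
  weight_ne_zero : ∀ j, weight j ≠ 0
  zero_ne_zero : ∀ A, toFun 0 A ≠ 0
  transpose : ∀ k A, toFun k Aᵀ = toFun k A
  expand : ∀ k (A : Matrix (Fin (k + 1)) (Fin (k + 1)) F),
    toFun (k + 1) A = ∑ j, A 0 j * (weight j * toFun k (A.submatrix Fin.succ j.succAbove))

namespace LaplaceFamily

/-- The determinant. -/
def det (F : Type*) [Field F] : LaplaceFamily F where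
  toFun _ A := A.det
  weight j := (-1) ^ j
  weight_ne_zero j := pow_ne_zero _ (neg_ne_zero.mpr one_ne_zero)
  zero_ne_zero A := by simp
  transpose _ A := det_transpose A
  expand k A := by
    rw [det_succ_row_zero]
    exact Fintype.sum_congr _ _ fun j => by ring

/-- The permanent. -/
def permanent (F : Type*) [Field F] : LaplaceFamily F where
  toFun _ A := A.permanent
  weight _ := 1
  weight_ne_zero _ := one_ne_zero
  zero_ne_zero A := by simp [permanent_isEmpty]
  transpose _ A := permanent_transpose A
  expand k A := by simpa using permanent_succ_row_zero A

variable {F : Type*} [Field F] (d : LaplaceFamily F)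

/-- The coefficients of the expansion along the first row. -/
def coeff {m : ℕ} (M : Matrix (Fin m) (Fin (m + 1)) F) (j : Fin (m + 1)) : F :=
  d.weight j * d.toFun m (M.submatrix id j.succAbove)

theorem toFun_vecCons {m : ℕ} (u : Fin (m + 1) → F) (M : Fin m → Fin (m + 1) → F) :
    d.toFun (m + 1) (of (vecCons u M)) = ∑ j, u j * d.coeff (of M) j :=
  d.expand m _

end LaplaceFamily

section Counting

variable {F : Type*} [Field F] [Fintype F] [DecidableEq F]

/-- A nonzero linear form on `F ^ k` takes every value equally often. -/
theorem card_filter_sum_mul_eq {k : ℕ} (c : Fin k → F) (hc : c ≠ 0) (a : F) :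
    #{u : Fin k → F | ∑ j, u j * c j = a} * Fintype.card F = Fintype.card F ^ k := by
  let f : (Fin k → F) →+ F :=
    { toFun := fun u => ∑ j, u j * c j
      map_zero' := by simp
      map_add' := fun u v => by simp [add_mul, sum_add_distrib] }
  have hf : Function.Surjective f := fun b => by
    obtain ⟨j, hj⟩ := Function.ne_iff.mp hc
    refine ⟨Pi.single j (b / c j), ?_⟩
    simp only [f, AddMonoidHom.coe_mk, ZeroHom.coe_mk]
    rw [Fintype.sum_eq_single j fun i hi => by simp [hi]]
    simpa using div_mul_cancel₀ b hj
  have h := card_eq_sum_card_fiberwise (f := f) (s := univ) (t := univ) (by simp)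
  rw [sum_congr rfl fun b _ => AddMonoidHom.card_fiber_eq_of_mem_range f (hf b) (hf a)] at h
  simp only [sum_const, card_univ, smul_eq_mul, Fintype.card_fun, Fintype.card_fin] at h
  rw [h, mul_comm]
  rfl

theorem card_filter_vecCons {V : Type*} [Fintype V] {m : ℕ} (P : (Fin (m + 1) → V) → Prop)
    [DecidablePred P] :
    #{A | P A} = ∑ M : Fin m → V, #{u : V | P (vecCons u M)} := by
  simp only [card_filter]
  rw [← (Fin.consEquiv fun _ => V).sum_comp, Fintype.sum_prod_type_right]
  rfl

namespace LaplaceFamily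

variable (d : LaplaceFamily F)

/-- The matrices with one more column than rows all of whose maximal minors vanish. -/
def degenerate (m : ℕ) : Finset (Matrix (Fin m) (Fin (m + 1)) F) :=
  {M | ∀ j : Fin (m + 1), d.toFun m (M.submatrix id j.succAbove) = 0}

theorem coeff_eq_zero_iff {m : ℕ} (M : Matrix (Fin m) (Fin (m + 1)) F) :
    d.coeff M = 0 ↔ M ∈ d.degenerate m := by
  simp [funext_iff, coeff, degenerate, d.weight_ne_zero]

/-- Deleting a row instead of a column makes the row-by-row count applicable. -/
theorem card_degenerate_eq (m : ℕ) :
    #(d.degenerate m) = #{B : Fin (m + 1) → Fin m → F |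
      ∀ i : Fin (m + 1), d.toFun m (of fun x => B (i.succAbove x)) = 0} := by
  refine card_equiv ⟨fun M => of.symm Mᵀ, fun B => (of B)ᵀ, fun _ => rfl, fun _ => rfl⟩ fun M => ?_
  simp only [degenerate, mem_filter, mem_univ, true_and]
  refine forall_congr' fun i => ?_
  rw [← d.transpose]
  rfl

/-- Only the conditions omitting row 0 or row 1 are kept. They share the rows `M` below, so each
says that `coeff M` kills the remaining row; the two rows vary independently, whence the square. -/
theorem card_degenerate_succ_le (m : ℕ) :
    #(d.degenerate (m + 1)) ≤ ∑ M : Fin m → Fin (m + 1) → F,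
      #{u : Fin (m + 1) → F | ∑ j, u j * d.coeff (of M) j = 0} ^ 2 := by
  rw [card_degenerate_eq, card_filter_vecCons]
  simp only [card_filter]
  rw [← (Fin.consEquiv fun _ => Fin (m + 1) → F).sum_comp, Fintype.sum_prod_type_right]
  refine sum_le_sum fun M _ => ?_
  rw [sq, sum_mul_sum]
  refine sum_le_sum fun v _ => sum_le_sum fun u _ => ?_
  split_ifs with h hv hu hu <;> simp only [mul_one, mul_zero, le_refl, zero_le]
  · exact (hu ((d.toFun_vecCons u M).symm.trans
      ((congrArg (d.toFun (m + 1)) (funext fun x => by cases x using Fin.cases <;> rfl)).trans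
        (h 1)))).elim
  · exact (hv ((d.toFun_vecCons v M).symm.trans (h 0))).elim
  · exact (hv ((d.toFun_vecCons v M).symm.trans (h 0))).elim

theorem sum_ite_degenerate {R : Type*} [AddCommMonoid R] (m : ℕ) (c : R) :
    (∑ M : Fin m → Fin (m + 1) → F, if of M ∈ d.degenerate m then c else 0) =
      #(d.degenerate m) • c := by
  rw [of.sum_comp fun M => if M ∈ d.degenerate m then c else 0, sum_ite_mem, univ_inter, sum_const]

/-- The maximal minors vanish simultaneously with probability at most `m / q ^ 2`. -/
theorem card_degenerate_mul_le (m : ℕ) :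
    #(d.degenerate m) * Fintype.card F ^ 2 ≤ m * Fintype.card F ^ (m * (m + 1)) := by
  induction m with
  | zero =>
    have : d.degenerate 0 = ∅ := by
      ext M
      simp [degenerate, d.zero_ne_zero]
    simp [this]
  | succ m ih =>
    set q := Fintype.card F
    have key (M : Fin m → Fin (m + 1) → F) :
        #{u : Fin (m + 1) → F | ∑ j, u j * d.coeff (of M) j = 0} ^ 2 * q ^ 2 ≤
          q ^ (2 * (m + 1)) + if of M ∈ d.degenerate m then q ^ (2 * (m + 1)) * q ^ 2 else 0 := by
      split_ifs with h
      · refine le_add_left (Nat.mul_le_mul_right _ ?_)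
        rw [mul_comm 2, pow_mul]
        refine Nat.pow_le_pow_left ((card_le_univ _).trans_eq ?_) 2
        simp [q]
      · rw [← coeff_eq_zero_iff] at h
        rw [← mul_pow, card_filter_sum_mul_eq _ h, ← pow_mul, mul_comm 2, add_zero]
    calc #(d.degenerate (m + 1)) * q ^ 2
        ≤ (∑ M : Fin m → Fin (m + 1) → F,
            #{u : Fin (m + 1) → F | ∑ j, u j * d.coeff (of M) j = 0} ^ 2) * q ^ 2 :=
          Nat.mul_le_mul_right _ (d.card_degenerate_succ_le m)
      _ ≤ ∑ M : Fin m → Fin (m + 1) → F,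
            (q ^ (2 * (m + 1)) + if of M ∈ d.degenerate m then q ^ (2 * (m + 1)) * q ^ 2 else 0) := by
          rw [sum_mul]
          exact sum_le_sum fun M _ => key M
      _ = q ^ (m * (m + 1)) * q ^ (2 * (m + 1)) +
            #(d.degenerate m) * q ^ 2 * q ^ (2 * (m + 1)) := by
          rw [sum_add_distrib, sum_ite_degenerate, sum_const]
          simp only [card_univ, Fintype.card_fun, Fintype.card_fin, smul_eq_mul, ← pow_mul]
          rw [mul_comm (m + 1) m]
          ring
      _ ≤ q ^ (m * (m + 1)) * q ^ (2 * (m + 1)) +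
            m * q ^ (m * (m + 1)) * q ^ (2 * (m + 1)) := by gcongr
      _ = (m + 1 : ℕ) * q ^ ((m + 1) * (m + 1 + 1)) := by
          ring

/-- Nondegenerate lower rows contribute no error; each degenerate choice contributes at most `q ^ (m
+ 2)`. -/
theorem abs_card_mul_sub_le (m : ℕ) (a : F) :
    |(#{A : Fin (m + 1) → Fin (m + 1) → F | d.toFun (m + 1) (of A) = a} : ℝ) * Fintype.card F -
        (Fintype.card F : ℝ) ^ ((m + 1) * (m + 1))| ≤
      #(d.degenerate m) * (Fintype.card F : ℝ) ^ (m + 2) := by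
  set q := Fintype.card F
  have hsum : (q : ℝ) ^ ((m + 1) * (m + 1)) =
      ∑ _M : Fin m → Fin (m + 1) → F, (q : ℝ) ^ (m + 1) := by
    rw [sum_const, card_univ, Fintype.card_fun, Fintype.card_fun]
    simp only [Fintype.card_fin, nsmul_eq_mul, Nat.cast_pow, q]
    ring
  rw [card_filter_vecCons, hsum, Nat.cast_sum, sum_mul, ← sum_sub_distrib]
  refine (abs_sum_le_sum_abs _ _).trans ?_
  calc _ ≤ ∑ M : Fin m → Fin (m + 1) → F,
        if of M ∈ d.degenerate m then (q : ℝ) ^ (m + 2) else 0 := by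
        refine sum_le_sum fun M _ => ?_
        simp only [toFun_vecCons]
        have hq : (1 : ℝ) ≤ q := by exact_mod_cast Fintype.card_pos (α := F)
        split_ifs with h
        · have h1 : (#{u : Fin (m + 1) → F | ∑ j, u j * d.coeff (of M) j = a} : ℝ) ≤ q ^ (m + 1) := by
            exact_mod_cast (card_le_univ _).trans_eq (by simp [q])
          have h2 : (q : ℝ) ^ (m + 1) ≤ q ^ (m + 2) := pow_le_pow_right₀ hq (by omega)
          have h3 := mul_le_mul_of_nonneg_right h1 (zero_le_one.trans hq)
          rw [← pow_succ] at h3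
          refine abs_sub_le_of_nonneg_of_le (by positivity) h3 (by positivity) h2
        · rw [← coeff_eq_zero_iff] at h
          have := card_filter_sum_mul_eq _ h a
          rw [← Nat.cast_mul, this]
          simp [q]
    _ = _ := by
        rw [sum_ite_degenerate, nsmul_eq_mul]

theorem abs_uniformProb_sub_le (n : ℕ) (hn : 1 ≤ n) (a : F) :
    |uniformProb {A : Matrix (Fin n) (Fin n) F | d.toFun n A = a} - 1 / (Nat.card F : ℝ)| ≤
      n / (Nat.card F : ℝ) ^ 2 := by
  obtain ⟨m, rfl⟩ := Nat.exists_eq_add_of_le' hn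
  have h1 := d.abs_card_mul_sub_le m a
  have h2 := d.card_degenerate_mul_le m
  have hN : ({A : Matrix (Fin (m + 1)) (Fin (m + 1)) F | d.toFun (m + 1) A = a}).ncard =
      #{A : Fin (m + 1) → Fin (m + 1) → F | d.toFun (m + 1) (of A) = a} := by
    rw [← Set.ncard_coe_finset]
    simp
    rfl
  have hcard : Nat.card (Matrix (Fin (m + 1)) (Fin (m + 1)) F) =
      Fintype.card F ^ ((m + 1) * (m + 1)) := by
    rw [← Nat.card_congr (of (m := Fin (m + 1)) (n := Fin (m + 1)) (α := F))]
    simp [← pow_mul]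
  rw [uniformProb, hN, hcard, Nat.card_eq_fintype_card]
  have hq : (0 : ℝ) < Fintype.card F := by exact_mod_cast Fintype.card_pos (α := F)
  set q := Fintype.card F
  set N := #{A : Fin (m + 1) → Fin (m + 1) → F | d.toFun (m + 1) (of A) = a}
  have h3 : (#(d.degenerate m) : ℝ) * q ^ 2 ≤ m * q ^ (m * (m + 1)) := by exact_mod_cast h2
  push_cast
  have e : (N : ℝ) / q ^ ((m + 1) * (m + 1)) - 1 / q =
      (N * q - q ^ ((m + 1) * (m + 1))) / (q ^ ((m + 1) * (m + 1)) * q) := by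
    field_simp
  rw [e, abs_div, abs_of_pos (by positivity : (0 : ℝ) < q ^ ((m + 1) * (m + 1)) * q),
    div_le_div_iff₀ (by positivity) (by positivity)]
  calc _ ≤ (#(d.degenerate m) * (q : ℝ) ^ (m + 2)) * q ^ 2 := by gcongr
    _ = (#(d.degenerate m) * (q : ℝ) ^ 2) * q ^ (m + 2) := by ring
    _ ≤ (m * q ^ (m * (m + 1))) * q ^ (m + 2) := by gcongr
    _ = m * (q ^ ((m + 1) * (m + 1)) * q) := by ring
    _ ≤ _ := by gcongr; linarith

end LaplaceFamily

end Counting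

theorem mainTheorem4 (n : ℕ) (hn : 1 ≤ n) :
    ∃ C : ℝ, ∀ (F : Type*) [Field F] [Finite F], ringChar F ≠ 2 → ∀ α : F,
      |uniformProb {A : Matrix (Fin n) (Fin n) F | A.det = α} - 1 / (Nat.card F : ℝ)|
          ≤ C / (Nat.card F : ℝ) ^ 2 ∧
      |uniformProb {A : Matrix (Fin n) (Fin n) F | A.permanent = α} - 1 / (Nat.card F : ℝ)|
          ≤ C / (Nat.card F : ℝ) ^ 2 := by
  refine ⟨n, fun F _ _ _ α => ?_⟩
  classical
  have := Fintype.ofFinite F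
  exact ⟨(LaplaceFamily.det F).abs_uniformProb_sub_le n hn α,
    (LaplaceFamily.permanent F).abs_uniformProb_sub_le n hn α⟩
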